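/- Let $S^2\subset\mathbb{R}^3$ be the unit sphere with its round metric $h$. For a smooth map $\varphi:\mathbb{R}^2\to S^2$ let $\varphi^*h$ be the pulled back metric, a symmetric $(0,2)$ tensor on $\mathbb{R}^2$, with divergence $(\operatorname{div}\varphi^*h)(X)=\sum_{i=1}^2(\nabla_{e_i}\varphi^*h)(e_i,X)$, and let $E_2(\varphi)=\frac12\int_{\mathbb{R}^2}|d\varphi|^2$. The map $\varphi$ is called *restricted harmonic* if it is smooth, $E_2(\varphi)<\infty$, and $\frac{d}{dt}\big|_{t=0}E_2(\varphi\circ\psi_t)=0$ for every smooth curve $\psi_t$, with $\psi_0=\mathrm{id}$, in the group of compactly supported volume preserving diffeomorphisms of $\mathbb{R}^2$ (smooth curve: $(t,x)\mapsto\psi_t(x)$ is smooth and, locally uniformly in $t$, the supports of the $\psi_t$ lie in one compact set). Let $B\in\mathbb{Z}$ and let $f:[0,\infty)\to\mathbb{R}$ be smooth on $(0,\infty)$ with $f(0)=\pi$ and $f(r)\to0$ as $r\to\infty$. Suppose that the map given in polar coordinates by $$\varphi(r,\theta)=(\sin f(r)\cos B\theta,\ \sin f(r)\sin B\theta,\ \cos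 f(r))$$ is smooth on $\mathbb{R}^2$; call such a $\varphi$ *axially symmetric* with profile $f$ and charge $B$. Then: 1. On $\mathbb{R}^2\setminus\{0\}$, $$\varphi^*h=f'(r)^2\,dr^2+B^2\sin^2 f(r)\,d\theta^2,\qquad \operatorname{div}\varphi^*h=2f'(r)f''(r)\,dr+\Big[f'(r)^2-\frac{B^2}{r^2}\sin^2 f(r)\Big]\frac{dr}{r}.$$ The one-form $\operatorname{div}\varphi^*h$ is closed and exact on $\mathbb{R}^2$. If moreover $E_2(\varphi)<\infty$, then $\varphi$ is restricted harmonic and has degree $B$. Here the degree of a smooth map $\varphi:\mathbb{R}^2\to S^2$ with $E_2(\varphi)<\infty$ which has a limit at infinity is $-\frac1{4\pi}\int_{\mathbb{R}^2}\varphi\cdot(\partial_1\varphi\times\partial_2\varphi)\,dx$, that is, its topological degree when $S^2$ is oriented as the Riemann sphere by stereographic projection $(y_0+iy_1)/(1-y_2)$ from $(0,0,1)$. 2. For every $B\in\mathbb{Z}$ there is an axially symmetric map of charge $B$, with a profile that vanishes for all sufficiently large $r$, which is restricted harmonic and has degree $B$. 3. Let $\varphi_1,\dots,\varphi_n$ be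 axially symmetric maps with charges $B_i$ and profiles $f_i$ such that $f_i(r)=0$ for all $r\ge R_i$, and let $c_1,\dots,c_n\in\mathbb{R}^2$ satisfy $|c_i-c_j|\ge R_i+R_j$ for $i\ne j$. Then the map $\Phi:\mathbb{R}^2\to S^2$ with $\Phi(x)=\varphi_i(x-c_i)$ if $|x-c_i|\le R_i$, and $\Phi(x)=(0,0,1)$ if $|x-c_i|>R_i$ for all $i$, is restricted harmonic. -/

import Mathlib

open Set Filter Topology MeasureTheory
open scoped Manifold ContDiff ENNReal

noncomputable section

namespace BabySkyrme

/-- The Euclidean plane with its standard metric `g`. -/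
abbrev Plane : Type := EuclideanSpace ℝ (Fin 2)

/-- Euclidean three-space. -/
abbrev Space : Type := EuclideanSpace ℝ (Fin 3)

/-- The unit sphere in Euclidean three-space, with Mathlib's smooth structure. Its metric `h` is
the one induced from the ambient space. -/
abbrev S2 : Type := Metric.sphere (0 : Space) 1

instance finrankSpace : Fact (Module.finrank ℝ Space = 2 + 1) := ⟨by simp⟩

/-- The standard orthonormal frame of the plane. -/
def frame (i : Fin 2) : Plane := EuclideanSpace.single i (1 : ℝ)

/-- The point of the plane with polar coordinates `(r, θ)`. -/
def polarPoint (r θ : ℝ) : Plane := !₂[r * Real.cos θ, r * Real.sin θ]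

/-- The one-form `dr` (used away from the origin). -/
def dr (x : Plane) : Plane →L[ℝ] ℝ := fderiv ℝ (fun y : Plane => ‖y‖) x

/-- The one-form `dθ = (x₀ dx₁ - x₁ dx₀) / r²` (used away from the origin). -/
def dθ (x : Plane) : Plane →L[ℝ] ℝ :=
  (1 / ‖x‖ ^ 2) •
    (x 0 • (EuclideanSpace.proj 1 : Plane →L[ℝ] ℝ) -
      x 1 • (EuclideanSpace.proj 0 : Plane →L[ℝ] ℝ))

/-- The smooth maps from the plane to the sphere. -/
def IsSmooth (φ : Plane → S2) : Prop :=
  ContMDiff 𝓘(ℝ, Plane) (𝓡 2) ∞ φ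

/-- The differential of `φ`, with the tangent planes of the sphere seen in the ambient space. -/
def differential (φ : Plane → S2) (x : Plane) : Plane →L[ℝ] Space :=
  fderiv ℝ (fun y => (φ y : Space)) x

/-- The pullback `φ^*h` of the round metric, a symmetric `(0,2)` tensor field on the plane:
`(φ^*h)(v, w) = ⟪dφ v, dφ w⟫`. -/
def pullbackMetric (φ : Plane → S2) (x : Plane) : Plane →L[ℝ] Plane →L[ℝ] ℝ :=
  (innerSL ℝ : Space →L[ℝ] Space →L[ℝ] ℝ).bilinearComp (differential φ x) (differential φ x)

/-- The Dirichlet energy `E₂(φ) = ½ ∫ |dφ|²`, where `|dφ|² = ∑ᵢ (φ^*h)(eᵢ, eᵢ)`. -/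
def dirichletEnergy (φ : Plane → S2) : ℝ≥0∞ :=
  ∫⁻ x : Plane, ENNReal.ofReal (1 / 2 * ∑ i : Fin 2, pullbackMetric φ x (frame i) (frame i))

/-- The divergence `(div α)(X) = ∑ᵢ (∇_{eᵢ} α)(eᵢ, X)` of a `(0,2)` tensor field on the plane
(the Levi-Civita connexion of the flat metric is the ordinary derivative). -/
def divergence (α : Plane → Plane →L[ℝ] Plane →L[ℝ] ℝ) (x : Plane) : Plane →L[ℝ] ℝ :=
  ∑ i : Fin 2, fderiv ℝ α x (frame i) (frame i)

/-- A closed one-form: smooth, with `dη(v, w) = (D_v η)(w) - (D_w η)(v) = 0`. -/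
def IsClosedOneForm (η : Plane → Plane →L[ℝ] ℝ) : Prop :=
  ContDiff ℝ ∞ η ∧ ∀ x v w : Plane, fderiv ℝ η x v w - fderiv ℝ η x w v = 0

/-- An exact one-form: the differential of a smooth function on the whole plane. -/
def IsExactOneForm (η : Plane → Plane →L[ℝ] ℝ) : Prop :=
  ∃ u : Plane → ℝ, ContDiff ℝ ∞ u ∧ ∀ x : Plane, η x = fderiv ℝ u x

/-- The volume preserving diffeomorphisms of the plane with compact support. -/
def SDiff : Set (Plane ≃ₘ^∞⟮𝓘(ℝ, Plane), 𝓘(ℝ, Plane)⟯ Plane) :=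
  {ψ | (∀ x : Plane, (fderiv ℝ (ψ : Plane → Plane) x).det = 1) ∧
    IsCompact (closure {x : Plane | ψ x ≠ x})}

/-- A smooth curve in `SDiff` through the identity at time `0`: it is jointly smooth in time and
space, and near every time the supports lie in one compact set (as for every smooth curve in the
Lie group of compactly supported diffeomorphisms). -/
structure IsSDiffCurve (ψ : ℝ → Plane ≃ₘ^∞⟮𝓘(ℝ, Plane), 𝓘(ℝ, Plane)⟯ Plane) : Prop where
  mem : ∀ t : ℝ, ψ t ∈ SDiff
  zero : ∀ x : Plane, ψ 0 x = x
  smooth : ContDiff ℝ ∞ (fun p : ℝ × Plane => ψ p.1 p.2)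
  support : ∀ t₀ : ℝ, ∃ K : Set Plane, IsCompact K ∧
    ∀ᶠ t in 𝓝 t₀, ∀ x : Plane, x ∉ K → ψ t x = x

/-- A restricted harmonic map: smooth, of finite Dirichlet energy, and critical for the Dirichlet
energy along every smooth curve of compactly supported volume preserving diffeomorphisms through
the identity. -/
structure RestrictedHarmonic (φ : Plane → S2) : Prop where
  smooth : IsSmooth φ
  finite_energy : dirichletEnergy φ < ⊤
  critical : ∀ ψ : ℝ → Plane ≃ₘ^∞⟮𝓘(ℝ, Plane), 𝓘(ℝ, Plane)⟯ Plane, IsSDiffCurve ψ →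
    HasDerivAt (fun t : ℝ => (dirichletEnergy (φ ∘ ψ t)).toReal) 0 0

/-- The density of the pullback of the normalized area form of the sphere,
`-(1/4π) det(φ, ∂₁φ, ∂₂φ)`. The sphere carries the orientation of the Riemann sphere, for which
stereographic projection `(y₀ + i y₁) / (1 - y₂)` from `(0,0,1)` preserves orientation; it is
opposite to that of the outward normal, whence the sign. -/
def chargeDensity (φ : Plane → S2) (x : Plane) : ℝ :=
  -(1 / (4 * Real.pi)) *
    Matrix.det (Matrix.of
      ![fun k : Fin 3 => (φ x : Space) k,
        fun k : Fin 3 => differential φ x (frame 0) k,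
        fun k : Fin 3 => differential φ x (frame 1) k])

/-- `φ` is a smooth map of finite Dirichlet energy which is constant at infinity and has
topological degree `d`. -/
structure HasDegree (φ : Plane → S2) (d : ℤ) : Prop where
  smooth : IsSmooth φ
  finite_energy : dirichletEnergy φ < ⊤
  limit : ∃ p : S2, Tendsto φ (cocompact Plane) (𝓝 p)
  integrable : Integrable (chargeDensity φ)
  integral_eq : ∫ x : Plane, chargeDensity φ x = (d : ℝ)

/-- `φ` is the axially symmetric smooth map with winding number `B` and profile function `f`,
`φ(r, θ) = (sin f(r) cos Bθ, sin f(r) sin Bθ, cos f(r))`, `f(0) = π`, `f(∞) = 0`. -/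
structure IsAxiallySymmetric (B : ℤ) (f : ℝ → ℝ) (φ : Plane → S2) : Prop where
  profile_smooth : ContDiffOn ℝ ∞ f (Ioi 0)
  profile_zero : f 0 = Real.pi
  profile_infty : Tendsto f atTop (𝓝 0)
  smooth : IsSmooth φ
  form : ∀ r θ : ℝ, 0 ≤ r → (φ (polarPoint r θ) : Space) =
    !₂[Real.sin (f r) * Real.cos (B * θ), Real.sin (f r) * Real.sin (B * θ), Real.cos (f r)]

/-- `Φ` is the superposition of the fields `φᵢ` translated to the centres `cᵢ`: the discs of radius
`Rᵢ` about `cᵢ` do not overlap, `Φ` is the translate of `φᵢ` on the `i`-th disc, and `Φ` takes the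
value `(0,0,1)` off all discs. -/
structure IsSuperposition {n : ℕ} (c : Fin n → Plane) (R : Fin n → ℝ) (φ : Fin n → Plane → S2)
    (Φ : Plane → S2) : Prop where
  disjoint : ∀ i j : Fin n, i ≠ j → R i + R j ≤ dist (c i) (c j)
  inside : ∀ (i : Fin n) (x : Plane), dist x (c i) ≤ R i → Φ x = φ i (x - c i)
  outside : ∀ x : Plane, (∀ i : Fin n, R i < dist x (c i)) → (Φ x : Space) = !₂[0, 0, 1]

end BabySkyrme

end

/-! Along a curve with initial velocity X the first variation of E₂ is ∫ Σᵢ ⟨∂ᵢφ, ∂ᵢ(dφ X)⟩. With e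
the energy density and Δφ the Laplacian taken componentwise in ℝ³, one has div φ^*h = ⟨Δφ, dφ ·⟩ +
de. If this form equals du and div X = 0, the integrand is therefore the divergence of the field
with components ⟨∂ᵢφ, dφ X⟩ - (u - e)Xᵢ. That field has compact support, so the variation vanishes.
Volume preservation gives div X = 0, so exactness of div φ^*h suffices
(`restrictedHarmonic_of_isExactOneForm`).

For an axially symmetric map, φ^*h is diagonal in dr, dθ with radial coefficients, so off the origin
its divergence is m(r)(x₀dx₀ + x₁dx₁), which is closed. Continuity extends closedness across the
origin and the Poincaré lemma gives a primitive. The charge density is radial and integrates to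
(B/2)(cos f(∞) - cos f(0)) = B.

For a superposition, each translate has zero differential off its open disc, boundary circle
included. Hence Φ^*h is the sum of the translated tensors, and the primitives add up. Examples in
every degree come from a profile equal to π near the origin, which makes the map locally constant
there. -/

namespace BabySkyrme

/-! ### Pullback metric, divergence and energy density -/

section

variable {φ : Plane → S2}

theorem IsSmooth.contDiff_coe (h : IsSmooth φ) : ContDiff ℝ ∞ (fun y => (φ y : Space)) :=
  (contMDiff_coe_sphere.comp h).contDiff

theorem pullbackMetric_apply (φ : Plane → S2) (x v w : Plane) :
    pullbackMetric φ x v w = inner ℝ (differential φ x v) (differential φ x w) := rfl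

theorem contDiff_fderiv_apply {E F : Type*} [NormedAddCommGroup E] [NormedSpace ℝ E]
    [NormedAddCommGroup F] [NormedSpace ℝ F] {g : E → F} (hg : ContDiff ℝ ∞ g) (v : E) :
    ContDiff ℝ ∞ (fun x => fderiv ℝ g x v) :=
  (contDiff_infty_iff_fderiv.1 hg).2.clm_apply contDiff_const

theorem IsSmooth.contDiff_pullbackMetric_apply (h : IsSmooth φ) (v w : Plane) :
    ContDiff ℝ ∞ (fun x => pullbackMetric φ x v w) :=
  (contDiff_fderiv_apply h.contDiff_coe v).inner ℝ (contDiff_fderiv_apply h.contDiff_coe w)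

theorem IsSmooth.contDiff_pullbackMetric (h : IsSmooth φ) :
    ContDiff ℝ ∞ (pullbackMetric φ) :=
  contDiff_clm_apply_iff.2 fun v => contDiff_clm_apply_iff.2 fun w =>
    h.contDiff_pullbackMetric_apply v w

theorem divergence_apply {α : Plane → Plane →L[ℝ] Plane →L[ℝ] ℝ} {x : Plane}
    (hα : DifferentiableAt ℝ α x) (w : Plane) :
    divergence α x w = ∑ i : Fin 2, fderiv ℝ (fun y => α y (frame i) w) x (frame i) := by
  simp only [divergence, sum_apply]
  refine Finset.sum_congr rfl fun i _ => ?_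
  have h := (hα.hasFDerivAt.clm_apply (hasFDerivAt_const (frame i) x)).clm_apply
    (hasFDerivAt_const w x)
  rw [h.fderiv]
  simp

theorem IsSmooth.contDiff_divergence (h : IsSmooth φ) :
    ContDiff ℝ ∞ (divergence (pullbackMetric φ)) := by
  refine ContDiff.sum fun i _ => ?_
  exact (contDiff_fderiv_apply h.contDiff_pullbackMetric (frame i)).clm_apply contDiff_const

theorem sum_smul_frame (v : Plane) : v = ∑ i : Fin 2, v i • frame i := by
  ext j
  fin_cases j <;> simp [frame]

theorem map_eq_sum_frame {F : Type*} [NormedAddCommGroup F] [NormedSpace ℝ F]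
    (L : Plane →L[ℝ] F) (v : Plane) : L v = ∑ i : Fin 2, v i • L (frame i) := by
  conv_lhs => rw [sum_smul_frame v]
  simp

/-- The Dirichlet energy density. -/
noncomputable def energyDensity (φ : Plane → S2) (x : Plane) : ℝ :=
  1 / 2 * ∑ i : Fin 2, pullbackMetric φ x (frame i) (frame i)

theorem energyDensity_nonneg (φ : Plane → S2) (x : Plane) : 0 ≤ energyDensity φ x :=
  mul_nonneg (by norm_num) (Finset.sum_nonneg fun i _ =>
    real_inner_self_nonneg (x := differential φ x (frame i)))

theorem IsSmooth.contDiff_energyDensity (h : IsSmooth φ) : ContDiff ℝ ∞ (energyDensity φ) :=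
  contDiff_const.mul (ContDiff.sum fun _ _ => h.contDiff_pullbackMetric_apply _ _)

theorem IsSmooth.integrable_energyDensity_iff (h : IsSmooth φ) :
    Integrable (energyDensity φ) ↔ dirichletEnergy φ < ⊤ := by
  have hm : AEStronglyMeasurable (energyDensity φ) volume :=
    h.contDiff_energyDensity.continuous.aestronglyMeasurable
  rw [Integrable, and_iff_right hm,
    hasFiniteIntegral_iff_ofReal (ae_of_all _ (energyDensity_nonneg φ))]
  rfl

theorem toReal_dirichletEnergy (h : IsSmooth φ) :
    (dirichletEnergy φ).toReal = ∫ x, energyDensity φ x :=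
  (integral_eq_lintegral_of_nonneg_ae (ae_of_all _ (energyDensity_nonneg φ))
    h.contDiff_energyDensity.continuous.aestronglyMeasurable).symm

/-! ### Integration by parts and differentiation under the integral -/

theorem integral_fderiv_apply_eq_zero {g : Plane → ℝ} (hg : ContDiff ℝ ∞ g)
    (hc : HasCompactSupport g) (v : Plane) : ∫ x, fderiv ℝ g x v = 0 := by
  have hd : Integrable (fun x => fderiv ℝ g x v) :=
    (contDiff_fderiv_apply hg v).continuous.integrable_of_hasCompactSupport
      (hc.fderiv_apply (𝕜 := ℝ) v)
  have hi : Integrable g := hg.continuous.integrable_of_hasCompactSupport hc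
  have := integral_mul_fderiv_eq_neg_fderiv_mul_of_integrable (μ := volume)
    (f := fun _ : Plane => (1 : ℝ)) (g := g) (v := v) (by simp) (by simpa using hd) (by simpa using hi)
    (fun _ _ => differentiableAt_const _)
    (fun x _ => (hg.differentiable (by simp)) x)
  simpa using this

/-- Differentiation under the integral sign for an integrand that depends on the parameter only
over a compact set. -/
theorem hasDerivAt_integral_of_eq_off_compact {F : ℝ × Plane → ℝ} (hF : ContDiff ℝ ∞ F)
    {K : Set Plane} (hK : IsCompact K) (hFK : ∀ᶠ t in 𝓝 (0 : ℝ), ∀ x ∉ K, F (t, x) = F (0, x))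
    (hint : Integrable (fun x => F (0, x))) :
    HasDerivAt (fun t => ∫ x, F (t, x)) (∫ x, fderiv ℝ F (0, x) (1, 0)) 0 := by
  obtain ⟨δ, hδ, hδK⟩ := Metric.eventually_nhds_iff.1 hFK
  set F' : ℝ × Plane → ℝ := fun p => fderiv ℝ F p (1, 0) with hF'
  have hF'c : Continuous F' := (contDiff_fderiv_apply hF (1, 0)).continuous
  have hder : ∀ (t : ℝ) (x : Plane), HasDerivAt (fun s => F (s, x)) (F' (t, x)) t := by
    intro t x
    have h1 : HasDerivAt (fun s : ℝ => (s, x)) ((1 : ℝ), (0 : Plane)) t :=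
      (hasDerivAt_id t).prodMk (hasDerivAt_const t x)
    exact ((hF.differentiable (by simp)) (t, x)).hasFDerivAt.comp_hasDerivAt t h1
  obtain ⟨C, hC⟩ := ((isCompact_Icc (a := -δ) (b := δ)).prod hK).exists_bound_of_continuousOn
    hF'c.continuousOn
  -- Off K the integrand does not depend on t, so a constant on K dominates the time derivative; F
  -- itself need not have compact support.
  have hz : ∀ x ∉ K, ∀ t ∈ Metric.ball (0 : ℝ) δ, F' (t, x) = 0 := by
    intro x hx t ht
    refine (hder t x).unique ((hasDerivAt_const t (F (0, x))).congr_of_eventuallyEq ?_)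
    filter_upwards [Metric.isOpen_ball.mem_nhds ht] with s hs using hδK hs x hx
  refine (hasDerivAt_integral_of_dominated_loc_of_deriv_le (μ := volume)
    (F := fun t x => F (t, x)) (F' := fun t x => F' (t, x)) (x₀ := (0 : ℝ))
    (bound := K.indicator fun _ => C) (Metric.ball_mem_nhds 0 hδ) ?_ hint ?_ ?_ ?_ ?_).2
  · exact Eventually.of_forall fun t =>
      (hF.continuous.comp (by fun_prop)).aestronglyMeasurable
  · exact (hF'c.comp (by fun_prop)).aestronglyMeasurable
  · refine ae_of_all _ fun x t ht => ?_
    by_cases hx : x ∈ K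
    · rw [indicator_of_mem hx]
      rw [Metric.mem_ball, Real.dist_0_eq_abs, abs_lt] at ht
      exact hC (t, x) ⟨⟨ht.1.le, ht.2.le⟩, hx⟩
    · rw [indicator_of_notMem hx, hz x hx t ht, norm_zero]
  · exact (integrable_indicator_iff hK.measurableSet).2
      (integrableOn_const hK.measure_lt_top.ne)
  · exact ae_of_all _ fun x t _ => hder t x

/-! ### Time and space derivatives, and the Jacobian in the standard frame -/

theorem two_le_smooth : minSmoothness ℝ 2 ≤ (∞ : ℕ∞ω) := by
  rw [minSmoothness_of_isRCLikeNormedField]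
  exact WithTop.coe_le_coe.2 (le_top : (2 : ℕ∞) ≤ ⊤)

section Slices

variable {F : Type*} [NormedAddCommGroup F] [NormedSpace ℝ F] {H : ℝ × Plane → F}

theorem fderiv_slice (hH : Differentiable ℝ H) (t : ℝ) (x v : Plane) :
    fderiv ℝ (fun y => H (t, y)) x v = fderiv ℝ H (t, x) (0, v) := by
  have h := (hH (t, x)).hasFDerivAt.comp x (hasFDerivAt_prodMk_right t x)
  exact congrArg (fun L => L v) h.fderiv

theorem hasDerivAt_slice (hH : Differentiable ℝ H) (t : ℝ) (x : Plane) :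
    HasDerivAt (fun s => H (s, x)) (fderiv ℝ H (t, x) (1, 0)) t :=
  (hH (t, x)).hasFDerivAt.comp_hasDerivAt t ((hasDerivAt_id t).prodMk (hasDerivAt_const t x))

/-- Time and space derivatives commute. -/
theorem fderiv_time_space (hH : ContDiff ℝ ∞ H) (t : ℝ) (x v : Plane) :
    fderiv ℝ (fun p => fderiv ℝ H p (0, v)) (t, x) (1, 0) =
      fderiv ℝ (fun y => fderiv ℝ H (t, y) (1, 0)) x v := by
  have hd : Differentiable ℝ (fderiv ℝ H) :=
    (contDiff_infty_iff_fderiv.1 hH).2.differentiable (by simp)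
  have h1 : ∀ w : ℝ × Plane, ∀ z, fderiv ℝ (fun p => fderiv ℝ H p w) (t, x) z =
      fderiv ℝ (fderiv ℝ H) (t, x) z w := by
    intro w z
    rw [((hd (t, x)).hasFDerivAt.clm_apply (hasFDerivAt_const w _)).fderiv]
    simp
  rw [fderiv_slice (H := fun p => fderiv ℝ H p (1, 0))
    ((contDiff_fderiv_apply hH _).differentiable (by simp)), h1, h1]
  exact (hH.contDiffAt.isSymmSndFDerivAt two_le_smooth) _ _

end Slices

theorem fderiv_fderiv_comm {F : Type*} [NormedAddCommGroup F] [NormedSpace ℝ F]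
    {G : Plane → F} (hG : ContDiff ℝ ∞ G) (x v w : Plane) :
    fderiv ℝ (fun y => fderiv ℝ G y v) x w = fderiv ℝ (fun y => fderiv ℝ G y w) x v := by
  have hd : Differentiable ℝ (fderiv ℝ G) :=
    (contDiff_infty_iff_fderiv.1 hG).2.differentiable (by simp)
  rw [((hd x).hasFDerivAt.clm_apply (hasFDerivAt_const v _)).fderiv,
    ((hd x).hasFDerivAt.clm_apply (hasFDerivAt_const w _)).fderiv]
  simpa using (hG.contDiffAt.isSymmSndFDerivAt (x := x) two_le_smooth) w v

theorem det_eq_frame (L : Plane →L[ℝ] Plane) :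
    L.det = L (frame 0) 0 * L (frame 1) 1 - L (frame 1) 0 * L (frame 0) 1 := by
  rw [ContinuousLinearMap.det,
    ← LinearMap.det_toMatrix (EuclideanSpace.basisFun (Fin 2) ℝ).toBasis, Matrix.det_fin_two]
  simp [LinearMap.toMatrix_apply, frame]

/-! ### Curves of volume preserving diffeomorphisms -/

section Curve

variable {ψ : ℝ → Plane ≃ₘ^∞⟮𝓘(ℝ, Plane), 𝓘(ℝ, Plane)⟯ Plane}

/-- The initial velocity of a curve of diffeomorphisms. -/
noncomputable def velocity (ψ : ℝ → Plane ≃ₘ^∞⟮𝓘(ℝ, Plane), 𝓘(ℝ, Plane)⟯ Plane)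
    (x : Plane) : Plane :=
  fderiv ℝ (fun p : ℝ × Plane => ψ p.1 p.2) (0, x) (1, 0)

theorem IsSDiffCurve.contDiff_velocity (hψ : IsSDiffCurve ψ) : ContDiff ℝ ∞ (velocity ψ) :=
  (contDiff_fderiv_apply hψ.smooth (1, 0)).comp (contDiff_const.prodMk contDiff_id)

theorem IsSDiffCurve.hasCompactSupport_velocity (hψ : IsSDiffCurve ψ) :
    HasCompactSupport (velocity ψ) := by
  obtain ⟨K, hK, hKψ⟩ := hψ.support 0
  refine HasCompactSupport.intro hK fun x hx => ?_
  refine (hasDerivAt_slice (hψ.smooth.differentiable (by simp)) 0 x).unique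
    ((hasDerivAt_const (0 : ℝ) x).congr_of_eventuallyEq ?_)
  filter_upwards [hKψ] with t ht using ht x hx

theorem IsSDiffCurve.contDiff_velocity_apply (hψ : IsSDiffCurve ψ) (i : Fin 2) :
    ContDiff ℝ ∞ (fun x => velocity ψ x i) :=
  contDiff_euclidean.1 hψ.contDiff_velocity i

theorem fderiv_euclidean_apply {E : Type*} [NormedAddCommGroup E] [NormedSpace ℝ E] {n : ℕ}
    {g : E → EuclideanSpace ℝ (Fin n)} {x : E} (hg : DifferentiableAt ℝ g x)
    (i : Fin n) (v : E) : fderiv ℝ (fun y => g y i) x v = fderiv ℝ g x v i := by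
  have h := (EuclideanSpace.proj i : EuclideanSpace ℝ (Fin n) →L[ℝ] ℝ).hasFDerivAt.comp x
    hg.hasFDerivAt
  exact congrArg (fun L => L v) h.fderiv

/-- The Jacobian determinant is constantly 1, and the derivative of the determinant at the identity
is the trace. -/
theorem IsSDiffCurve.sum_fderiv_velocity (hψ : IsSDiffCurve ψ) (x : Plane) :
    ∑ i : Fin 2, fderiv ℝ (fun y => velocity ψ y i) x (frame i) = 0 := by
  set Ψ : ℝ × Plane → Plane := fun p => ψ p.1 p.2 with hΨ
  have hs : ContDiff ℝ ∞ Ψ := hψ.smooth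
  have hd : Differentiable ℝ Ψ := hs.differentiable (by simp)
  have hM : ∀ i j : Fin 2, HasDerivAt (fun t => fderiv ℝ Ψ (t, x) (0, frame j) i)
      (fderiv ℝ (fun y => velocity ψ y i) x (frame j)) 0 := by
    intro i j
    have h := hasDerivAt_slice (H := fun p => fderiv ℝ Ψ p (0, frame j) i)
      ((contDiff_euclidean.1 (contDiff_fderiv_apply hs (0, frame j)) i).differentiable (by simp))
      0 x
    refine h.congr_deriv ?_
    rw [fderiv_euclidean_apply ((contDiff_fderiv_apply hs (0, frame j)).differentiable
      (by simp) _), fderiv_time_space hs,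
      fderiv_euclidean_apply (hψ.contDiff_velocity.differentiable (by simp) _)]
    rfl
  have h0 : ∀ v : Plane, fderiv ℝ Ψ (0, x) (0, v) = v := by
    intro v
    rw [← fderiv_slice hd]
    have : (fun y => Ψ (0, y)) = fun y => y := funext hψ.zero
    rw [this, fderiv_fun_id]
    rfl
  have hdet : ∀ t : ℝ, fderiv ℝ Ψ (t, x) (0, frame 0) 0 * fderiv ℝ Ψ (t, x) (0, frame 1) 1 -
      fderiv ℝ Ψ (t, x) (0, frame 1) 0 * fderiv ℝ Ψ (t, x) (0, frame 0) 1 = 1 := by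
    intro t
    rw [← (hψ.mem t).1 x, det_eq_frame]
    simp only [← fderiv_slice hd]
    rfl
  -- At t = 0 the matrix is the identity, so the product rule leaves only the derivatives of the
  -- diagonal entries.
  have hder := ((hM 0 0).mul (hM 1 1)).sub ((hM 0 1).mul (hM 1 0))
  have hconst : HasDerivAt (fun _ : ℝ => (1 : ℝ)) 0 0 := hasDerivAt_const _ _
  have := hder.unique (hconst.congr_of_eventuallyEq (Eventually.of_forall hdet))
  simp only [h0] at this
  simpa [frame, Fin.sum_univ_two] using this

end Curve

end

/-! ### First variation of the energy -/

section

variable {φ : Plane → S2}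

theorem IsSmooth.comp_diffeomorph (h : IsSmooth φ)
    (χ : Plane ≃ₘ^∞⟮𝓘(ℝ, Plane), 𝓘(ℝ, Plane)⟯ Plane) : IsSmooth (φ ∘ χ) :=
  ContMDiff.comp h χ.contMDiff

theorem fderiv_inner_fderiv_apply {G : Plane → Space} (hG : ContDiff ℝ ∞ G) (x v w z : Plane) :
    fderiv ℝ (fun y => inner ℝ (fderiv ℝ G y v) (fderiv ℝ G y w)) x z =
      inner ℝ (fderiv ℝ G x v) (fderiv ℝ (fun y => fderiv ℝ G y w) x z) +
        inner ℝ (fderiv ℝ (fun y => fderiv ℝ G y v) x z) (fderiv ℝ G x w) :=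
  fderiv_inner_apply ℝ ((contDiff_fderiv_apply hG v).differentiable (by simp) x)
    ((contDiff_fderiv_apply hG w).differentiable (by simp) x) z

/-- The first variation density of the Dirichlet energy along a divergence free vector field is a
divergence, when the divergence of the pulled back metric is exact. -/
theorem variation_eq_sum_fderiv (h : IsSmooth φ) {u : Plane → ℝ} (hu : ContDiff ℝ ∞ u)
    (hdiv : ∀ x, divergence (pullbackMetric φ) x = fderiv ℝ u x) {X : Plane → Plane}
    (hX : ContDiff ℝ ∞ X)
    (hX0 : ∀ x, ∑ i : Fin 2, fderiv ℝ (fun y => X y i) x (frame i) = 0) (x : Plane) :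
    ∑ i : Fin 2, inner ℝ (differential φ x (frame i))
        (fderiv ℝ (fun y => differential φ y (X y)) x (frame i)) =
      ∑ i : Fin 2, fderiv ℝ (fun y => inner ℝ (differential φ y (frame i))
        (differential φ y (X y)) - (u y - energyDensity φ y) * X y i) x (frame i) := by
  have hG := h.contDiff_coe
  set G : Plane → Space := fun y => (φ y : Space) with hGdef
  have hdG : ∀ v, DifferentiableAt ℝ (fun y => fderiv ℝ G y v) x := fun v =>
    (contDiff_fderiv_apply hG v).differentiable (by simp) x
  have hXi : ∀ i, DifferentiableAt ℝ (fun y => X y i) x := fun i =>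
    (contDiff_euclidean.1 hX i).differentiable (by simp) x
  have hY : ContDiff ℝ ∞ (fun y => fderiv ℝ G y (X y)) :=
    (contDiff_infty_iff_fderiv.1 hG).2.clm_apply hX
  have hYd : DifferentiableAt ℝ (fun y => fderiv ℝ G y (X y)) x := hY.differentiable (by simp) x
  have hud : DifferentiableAt ℝ u x := hu.differentiable (by simp) x
  have hed : DifferentiableAt ℝ (energyDensity φ) x :=
    h.contDiff_energyDensity.differentiable (by simp) x
  -- By the hypothesis on u, ∂ⱼu = ⟨Δφ, ∂ⱼφ⟩ + Σᵢ ⟨∂ᵢφ, ∂ᵢ∂ⱼφ⟩; the last sum is ∂ⱼe once the second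
  -- derivatives commute.
  have hu' : ∀ j, fderiv ℝ u x (frame j) = ∑ i : Fin 2,
      (inner ℝ (fderiv ℝ G x (frame i))
        (fderiv ℝ (fun y => fderiv ℝ G y (frame j)) x (frame i)) +
      inner ℝ (fderiv ℝ (fun y => fderiv ℝ G y (frame i)) x (frame i))
        (fderiv ℝ G x (frame j))) := by
    intro j
    rw [← hdiv, divergence_apply (h.contDiff_pullbackMetric.differentiable (by simp) x)]
    exact Finset.sum_congr rfl fun i _ => fderiv_inner_fderiv_apply hG x _ _ _
  have he' : ∀ j, fderiv ℝ (energyDensity φ) x (frame j) = ∑ i : Fin 2,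
      inner ℝ (fderiv ℝ G x (frame i))
        (fderiv ℝ (fun y => fderiv ℝ G y (frame i)) x (frame j)) := by
    intro j
    have hd : ∀ i ∈ Finset.univ, DifferentiableAt ℝ
        (fun y => pullbackMetric φ y (frame i) (frame i)) x := fun i _ =>
      (h.contDiff_pullbackMetric_apply _ _).differentiable (by simp) x
    have : energyDensity φ = fun y =>
      (1 / 2 : ℝ) * ∑ i : Fin 2, pullbackMetric φ y (frame i) (frame i) := rfl
    rw [this, fderiv_const_mul (DifferentiableAt.fun_sum hd), fderiv_fun_sum hd]
    simp only [smul_apply, sum_apply, smul_eq_mul]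
    rw [Finset.mul_sum]
    refine Finset.sum_congr rfl fun i _ => ?_
    have := fderiv_inner_fderiv_apply hG x (frame i) (frame i) (frame j)
    rw [real_inner_comm (fderiv ℝ G x (frame i)) (fderiv ℝ (fun y => fderiv ℝ G y (frame i)) x
      (frame j))] at this
    change 1 / 2 * fderiv ℝ (fun y => inner ℝ (fderiv ℝ G y (frame i))
      (fderiv ℝ G y (frame i))) x (frame j) = _
    rw [this]
    ring
  have hR : ∀ i : Fin 2, fderiv ℝ (fun y => inner ℝ (differential φ y (frame i))
        (differential φ y (X y)) - (u y - energyDensity φ y) * X y i) x (frame i) =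
      inner ℝ (fderiv ℝ G x (frame i)) (fderiv ℝ (fun y => fderiv ℝ G y (X y)) x (frame i)) +
      inner ℝ (fderiv ℝ (fun y => fderiv ℝ G y (frame i)) x (frame i)) (fderiv ℝ G x (X x)) -
      ((u x - energyDensity φ x) * fderiv ℝ (fun y => X y i) x (frame i) +
        X x i * (fderiv ℝ u x (frame i) - fderiv ℝ (energyDensity φ) x (frame i))) := by
    intro i
    have hin : DifferentiableAt ℝ (fun y => inner ℝ (fderiv ℝ G y (frame i))
      (fderiv ℝ G y (X y))) x := (hdG _).inner ℝ hYd
    change fderiv ℝ (fun y => inner ℝ (fderiv ℝ G y (frame i)) (fderiv ℝ G y (X y)) -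
      (u y - energyDensity φ y) * X y i) x (frame i) = _
    rw [fderiv_fun_sub hin ((hud.fun_sub hed).fun_mul (hXi i)),
      fderiv_fun_mul (hud.fun_sub hed) (hXi i), fderiv_fun_sub hud hed, sub_apply,
      fderiv_inner_apply ℝ (hdG _) hYd]
    simp
  have hYx : fderiv ℝ G x (X x) = ∑ j : Fin 2, X x j • fderiv ℝ G x (frame j) :=
    map_eq_sum_frame _ _
  have hX0x := hX0 x
  have hcomm := fderiv_fderiv_comm hG x (frame 0) (frame 1)
  rw [Finset.sum_congr rfl fun i _ => hR i]
  change ∑ i : Fin 2, inner ℝ (fderiv ℝ G x (frame i))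
        (fderiv ℝ (fun y => fderiv ℝ G y (X y)) x (frame i)) = _
  rw [hYx]
  simp only [hu', he', Fin.sum_univ_two, inner_add_right, inner_smul_right] at hX0x ⊢
  rw [hcomm]
  -- The one term left over is (u - e) div X.
  linear_combination (u x - energyDensity φ x) * hX0x

/-- A smooth map of finite energy is restricted harmonic if the divergence of the pulled back
metric is exact. -/
theorem restrictedHarmonic_of_isExactOneForm (h : IsSmooth φ) (hE : dirichletEnergy φ < ⊤)
    (hex : IsExactOneForm (divergence (pullbackMetric φ))) : RestrictedHarmonic φ := by
  refine ⟨h, hE, fun ψ hψ => ?_⟩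
  obtain ⟨u, hu, hdiv⟩ := hex
  have hG := h.contDiff_coe
  set G : Plane → Space := fun y => (φ y : Space) with hGdef
  set H : ℝ × Plane → Space := fun p => G (ψ p.1 p.2) with hHdef
  have hH : ContDiff ℝ ∞ H := hG.comp hψ.smooth
  have hHd : Differentiable ℝ H := hH.differentiable (by simp)
  set F : ℝ × Plane → ℝ := fun p => 1 / 2 * ∑ i : Fin 2,
    inner ℝ (fderiv ℝ H p (0, frame i)) (fderiv ℝ H p (0, frame i)) with hFdef
  have hF : ContDiff ℝ ∞ F := contDiff_const.mul (ContDiff.sum fun i _ =>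
    (contDiff_fderiv_apply hH _).inner ℝ (contDiff_fderiv_apply hH _))
  have hFe : ∀ t x, F (t, x) = energyDensity (φ ∘ ψ t) x := by
    intro t x
    simp only [hFdef, ← fderiv_slice hHd]
    rfl
  have h0 : φ ∘ ψ 0 = φ := funext fun x => congrArg φ (hψ.zero x)
  obtain ⟨K, hK, hKψ⟩ := hψ.support 0
  have hFK : ∀ᶠ t in 𝓝 (0 : ℝ), ∀ x ∉ K, F (t, x) = F (0, x) := by
    filter_upwards [hKψ] with t ht x hx
    -- K is closed, so ψ t is the identity on a whole neighbourhood of x, and the spatial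
    -- derivatives agree too.
    have hev : (fun y => H (t, y)) =ᶠ[𝓝 x] fun y => H (0, y) := by
      filter_upwards [hK.isClosed.isOpen_compl.mem_nhds hx] with y hy
      simp only [hHdef, ht y hy, hψ.zero]
    simp only [hFdef, ← fderiv_slice hHd, hev.fderiv_eq]
  have hint : Integrable (fun x => F (0, x)) := by
    simp only [hFe, h0]
    exact h.integrable_energyDensity_iff.2 hE
  have hmain := hasDerivAt_integral_of_eq_off_compact hF hK hFK hint
  have hfun : (fun t => (dirichletEnergy (φ ∘ ψ t)).toReal) = fun t => ∫ x, F (t, x) := by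
    funext t
    simp only [hFe]
    exact toReal_dirichletEnergy (h.comp_diffeomorph (ψ t))
  rw [hfun]
  refine hmain.congr_deriv ?_
  have hX := hψ.contDiff_velocity
  have hH0 : ∀ x v, fderiv ℝ H (0, x) (0, v) = differential φ x v := by
    intro x v
    rw [← fderiv_slice hHd]
    simp only [hHdef, hψ.zero]
    rfl
  -- Chain rule: the time derivative of φ ∘ ψ t at t = 0 is dφ(X).
  have hY : ∀ x, fderiv ℝ H (0, x) (1, 0) = differential φ x (velocity ψ x) := by
    intro x
    have := ((hG.differentiable (by simp) (ψ 0 x)).hasFDerivAt.comp ((0 : ℝ), x)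
      (hψ.smooth.differentiable (by simp) ((0 : ℝ), x)).hasFDerivAt).fderiv
    rw [hψ.zero] at this
    exact congrArg (fun L => L (1, 0)) this
  have hpt : ∀ x, fderiv ℝ F (0, x) (1, 0) = ∑ i : Fin 2,
      fderiv ℝ (fun y => inner ℝ (differential φ y (frame i))
        (differential φ y (velocity ψ y)) - (u y - energyDensity φ y) * velocity ψ y i) x
        (frame i) := by
    intro x
    rw [← variation_eq_sum_fderiv h hu hdiv hX hψ.sum_fderiv_velocity x]
    have hd : ∀ i : Fin 2, DifferentiableAt ℝ (fun p => fderiv ℝ H p (0, frame i)) (0, x) :=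
      fun i => (contDiff_fderiv_apply hH _).differentiable (by simp) _
    have hdi : ∀ i ∈ Finset.univ, DifferentiableAt ℝ (fun p => inner ℝ
        (fderiv ℝ H p (0, frame i)) (fderiv ℝ H p (0, frame i))) (0, x) :=
      fun i _ => (hd i).inner ℝ (hd i)
    rw [hFdef, fderiv_const_mul (DifferentiableAt.fun_sum hdi), fderiv_fun_sum hdi]
    simp only [smul_apply, sum_apply, smul_eq_mul]
    rw [Finset.mul_sum]
    refine Finset.sum_congr rfl fun i _ => ?_
    rw [fderiv_inner_apply ℝ (hd i) (hd i), fderiv_time_space hH, hH0, real_inner_comm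
      (differential φ x (frame i))]
    simp only [hY]
    ring
  simp only [hpt]
  have hYc : ContDiff ℝ ∞ (fun y => differential φ y (velocity ψ y)) :=
    (contDiff_infty_iff_fderiv.1 hG).2.clm_apply hX
  have hg : ∀ i : Fin 2, ContDiff ℝ ∞ (fun y => inner ℝ (differential φ y (frame i))
      (differential φ y (velocity ψ y)) - (u y - energyDensity φ y) * velocity ψ y i) := fun i =>
    ((contDiff_fderiv_apply hG _).inner ℝ hYc).sub
      ((hu.sub h.contDiff_energyDensity).mul (hψ.contDiff_velocity_apply i))
  have hgc : ∀ i : Fin 2, HasCompactSupport (fun y => inner ℝ (differential φ y (frame i))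
      (differential φ y (velocity ψ y)) - (u y - energyDensity φ y) * velocity ψ y i) := by
    refine fun i => hψ.hasCompactSupport_velocity.mono fun y hy hv => hy ?_
    simp [hv]
  rw [integral_finsetSum _ fun i _ => (contDiff_fderiv_apply (hg i)
    (frame i)).continuous.integrable_of_hasCompactSupport ((hgc i).fderiv_apply (𝕜 := ℝ) _)]
  exact Finset.sum_eq_zero fun i _ => integral_fderiv_apply_eq_zero (hg i) (hgc i) _

end

/-! ### Polar coordinates -/

section Polar

theorem norm_sq_plane (x : Plane) : ‖x‖ ^ 2 = x 0 ^ 2 + x 1 ^ 2 := by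
  rw [EuclideanSpace.norm_sq_eq]
  simp [Fin.sum_univ_two]

theorem norm_polarPoint {r : ℝ} (hr : 0 ≤ r) (θ : ℝ) : ‖polarPoint r θ‖ = r := by
  refine (pow_left_inj₀ (norm_nonneg _) hr two_ne_zero).1 ?_
  rw [norm_sq_plane]
  simp only [polarPoint, PiLp.toLp_apply, Matrix.cons_val_zero, Matrix.cons_val_one]
  linear_combination r ^ 2 * Real.sin_sq_add_cos_sq θ

theorem exists_eq_polarPoint (x : Plane) : ∃ θ : ℝ, x = polarPoint ‖x‖ θ := by
  set z : ℂ := ⟨x 0, x 1⟩ with hz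
  have hn : ‖z‖ = ‖x‖ := by
    refine (pow_left_inj₀ (norm_nonneg _) (norm_nonneg _) two_ne_zero).1 ?_
    rw [norm_sq_plane, Complex.sq_norm, Complex.normSq_apply]
    ring
  refine ⟨z.arg, ?_⟩
  ext i
  fin_cases i
  · simpa [polarPoint, hn] using (Complex.norm_mul_cos_arg z).symm
  · simpa [polarPoint, hn] using (Complex.norm_mul_sin_arg z).symm

theorem hasFDerivAt_coord (i : Fin 2) (x : Plane) :
    HasFDerivAt (fun y : Plane => y i) (EuclideanSpace.proj i : Plane →L[ℝ] ℝ) x :=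
  (EuclideanSpace.proj i : Plane →L[ℝ] ℝ).hasFDerivAt

theorem hasFDerivAt_norm {x : Plane} (hx : x ≠ 0) :
    HasFDerivAt (fun y : Plane => ‖y‖) (dr x) x :=
  (differentiableAt_id.norm ℝ hx).hasFDerivAt

theorem dr_apply {x : Plane} (hx : x ≠ 0) (v : Plane) :
    dr x v = (x 0 * v 0 + x 1 * v 1) / ‖x‖ := by
  -- Differentiating r² = x₀² + x₁² in two ways gives r dr = x₀dx₀ + x₁dx₁.
  have h1 := (hasFDerivAt_norm hx).fun_mul (hasFDerivAt_norm hx)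
  have h2 := ((hasFDerivAt_coord 0 x).fun_mul (hasFDerivAt_coord 0 x)).fun_add
    ((hasFDerivAt_coord 1 x).fun_mul (hasFDerivAt_coord 1 x))
  have he : (fun y : Plane => ‖y‖ * ‖y‖) = fun y => y 0 * y 0 + y 1 * y 1 := by
    funext y
    linear_combination norm_sq_plane y
  rw [he] at h1
  have := congrArg (fun L => L v) (h1.unique h2)
  simp at this
  rw [eq_div_iff (norm_ne_zero_iff.2 hx)]
  linear_combination this / 2

theorem dθ_apply (x v : Plane) : dθ x v = (x 0 * v 1 - x 1 * v 0) / ‖x‖ ^ 2 := by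
  simp [dθ]
  ring

end Polar

/-! ### Axially symmetric maps: differential, pullback metric, charge density -/

variable {B : ℤ} {f : ℝ → ℝ} {φ : Plane → S2}

namespace IsAxiallySymmetric

theorem hasDerivAt_profile (h : IsAxiallySymmetric B f φ) {r : ℝ} (hr : 0 < r) :
    HasDerivAt f (deriv f r) r :=
  ((h.profile_smooth.contDiffAt (Ioi_mem_nhds hr)).differentiableAt (by simp)).hasDerivAt

theorem hasDerivAt_deriv_profile (h : IsAxiallySymmetric B f φ) {r : ℝ} (hr : 0 < r) :
    HasDerivAt (deriv f) (deriv (deriv f) r) r :=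
  ((((contDiffOn_infty_iff_deriv_of_isOpen isOpen_Ioi).1 h.profile_smooth).2.contDiffAt
    (Ioi_mem_nhds hr)).differentiableAt (by simp)).hasDerivAt

theorem differential_radial (h : IsAxiallySymmetric B f φ) {r : ℝ} (hr : 0 < r) (θ : ℝ) :
    differential φ (polarPoint r θ) (!₂[Real.cos θ, Real.sin θ]) =
      !₂[Real.cos (f r) * deriv f r * Real.cos (B * θ),
        Real.cos (f r) * deriv f r * Real.sin (B * θ), -Real.sin (f r) * deriv f r] := by
  have hc : HasDerivAt (fun s => polarPoint s θ) (!₂[Real.cos θ, Real.sin θ] : Plane) r := by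
    have := (hasDerivAt_id r).smul_const (!₂[Real.cos θ, Real.sin θ] : Plane)
    rw [one_smul] at this
    refine this.congr_of_eventuallyEq (Eventually.of_forall fun s => ?_)
    ext i
    fin_cases i <;> simp [polarPoint]
  have hG : HasDerivAt (fun s => (φ (polarPoint s θ) : Space))
      (differential φ (polarPoint r θ) (!₂[Real.cos θ, Real.sin θ])) r :=
    ((h.smooth.contDiff_coe.differentiable (by simp) _).hasFDerivAt).comp_hasDerivAt r hc
  have hf := h.hasDerivAt_profile hr
  have hev : ∀ᶠ s in 𝓝 r, (φ (polarPoint s θ) : Space) = !₂[Real.sin (f s) * Real.cos (B * θ),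
      Real.sin (f s) * Real.sin (B * θ), Real.cos (f s)] := by
    filter_upwards [Ioi_mem_nhds hr] with s hs using h.form s θ (le_of_lt hs)
  have hk : ∀ k : Fin 3, HasDerivAt (fun s => (φ (polarPoint s θ) : Space) k)
      (differential φ (polarPoint r θ) (!₂[Real.cos θ, Real.sin θ]) k) r := fun k =>
    ((EuclideanSpace.proj k : Space →L[ℝ] ℝ).hasFDerivAt).comp_hasDerivAt r hG
  ext k
  fin_cases k
  · refine (hk 0).unique ((hf.sin.mul_const _).congr_of_eventuallyEq ?_)
    filter_upwards [hev] with s hs using by rw [hs]; rfl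
  · refine (hk 1).unique ((hf.sin.mul_const _).congr_of_eventuallyEq ?_)
    filter_upwards [hev] with s hs using by rw [hs]; rfl
  · refine (hk 2).unique (hf.cos.congr_of_eventuallyEq ?_)
    filter_upwards [hev] with s hs using by rw [hs]; rfl

/-- Differentiating along the circle of radius r, whose velocity is r times the unit angular vector;
keeping the factor r avoids a division. -/
theorem differential_angular (h : IsAxiallySymmetric B f φ) {r : ℝ} (hr : 0 < r) (θ : ℝ) :
    r • differential φ (polarPoint r θ) (!₂[-Real.sin θ, Real.cos θ]) =
      !₂[-(B * Real.sin (f r) * Real.sin (B * θ)), B * Real.sin (f r) * Real.cos (B * θ), 0] := by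
  have hc : HasDerivAt (fun t => polarPoint r t) (r • (!₂[-Real.sin θ, Real.cos θ] : Plane)) θ := by
    have := (((Real.hasDerivAt_cos θ).smul_const (frame 0)).fun_add
      ((Real.hasDerivAt_sin θ).smul_const (frame 1))).const_smul r
    refine (this.congr_of_eventuallyEq (Eventually.of_forall fun s => ?_)).congr_deriv ?_
    · ext i
      fin_cases i <;> simp [polarPoint, frame]
    · ext i
      fin_cases i <;> simp [frame]
  have hG : HasDerivAt (fun t => (φ (polarPoint r t) : Space))
      (r • differential φ (polarPoint r θ) (!₂[-Real.sin θ, Real.cos θ])) θ := by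
    rw [← map_smul]
    exact ((h.smooth.contDiff_coe.differentiable (by simp) _).hasFDerivAt).comp_hasDerivAt θ hc
  have he : ∀ t, (φ (polarPoint r t) : Space) = !₂[Real.sin (f r) * Real.cos (B * t),
      Real.sin (f r) * Real.sin (B * t), Real.cos (f r)] := fun t => h.form r t hr.le
  have hk : ∀ k : Fin 3, HasDerivAt (fun t => (φ (polarPoint r t) : Space) k)
      ((r • differential φ (polarPoint r θ) (!₂[-Real.sin θ, Real.cos θ])) k) θ := fun k =>
    ((EuclideanSpace.proj k : Space →L[ℝ] ℝ).hasFDerivAt).comp_hasDerivAt θ hG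
  have hB : HasDerivAt (fun t : ℝ => (B : ℝ) * t) B θ := by
    simpa using (hasDerivAt_id θ).const_mul (B : ℝ)
  simp only [he] at hk
  ext k
  fin_cases k
  · refine (hk 0).unique ((hB.cos.const_mul (Real.sin (f r))).congr_deriv ?_)
    simp
    ring
  · refine (hk 1).unique ((hB.sin.const_mul (Real.sin (f r))).congr_deriv ?_)
    simp
    ring
  · exact (hk 2).unique (hasDerivAt_const _ _)

theorem pullbackMetric_eq (h : IsAxiallySymmetric B f φ) {x : Plane} (hx : x ≠ 0) (v w : Plane) :
    pullbackMetric φ x v w = deriv f ‖x‖ ^ 2 * (dr x v * dr x w) +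
      (B : ℝ) ^ 2 * Real.sin (f ‖x‖) ^ 2 * (dθ x v * dθ x w) := by
  obtain ⟨θ, hθ⟩ := exists_eq_polarPoint x
  have hr : 0 < ‖x‖ := norm_pos_iff.2 hx
  have hx0 : x 0 = ‖x‖ * Real.cos θ := by
    conv_lhs => rw [hθ]
    simp [polarPoint]
  have hx1 : x 1 = ‖x‖ * Real.sin θ := by
    conv_lhs => rw [hθ]
    simp [polarPoint]
  have hA := h.differential_radial hr θ
  have hC := h.differential_angular hr θ
  rw [← hθ] at hA hC
  have hcs := Real.sin_sq_add_cos_sq θ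
  -- Each v is dr(v) times the unit radial vector plus dθ(v) times r times the unit angular one;
  -- their images under dφ are orthogonal, so no mixed term survives.
  have hdec : ∀ v : Plane, differential φ x v = dr x v •
      differential φ x (!₂[Real.cos θ, Real.sin θ]) +
      dθ x v • (‖x‖ • differential φ x (!₂[-Real.sin θ, Real.cos θ])) := by
    intro v
    rw [← map_smul, ← map_smul, ← map_smul, ← map_add]
    congr 1
    rw [dr_apply hx, dθ_apply, hx0, hx1]
    ext i
    fin_cases i
    · simp
      field_simp
      linear_combination (-v.ofLp 0) * hcs
    · simp
      field_simp
      linear_combination (-v.ofLp 1) * hcs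
  rw [pullbackMetric_apply, hdec v, hdec w, hA, hC]
  have hcb := Real.sin_sq_add_cos_sq (B * θ)
  have hcf := Real.sin_sq_add_cos_sq (f ‖x‖)
  simp [PiLp.inner_apply, Fin.sum_univ_three]
  set sb := Real.sin (B * θ)
  set cb := Real.cos (B * θ)
  set sf := Real.sin (f ‖x‖)
  set cf := Real.cos (f ‖x‖)
  set d := deriv f ‖x‖
  linear_combination (dr x v * dr x w * d ^ 2 * cf ^ 2 + dθ x v * dθ x w * B ^ 2 * sf ^ 2) * hcb +
    (dr x v * dr x w * d ^ 2) * hcf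

theorem chargeDensity_eq (h : IsAxiallySymmetric B f φ) {x : Plane} (hx : x ≠ 0) :
    chargeDensity φ x =
      -(1 / (4 * Real.pi)) * (B * deriv f ‖x‖ * Real.sin (f ‖x‖) / ‖x‖) := by
  obtain ⟨θ, hθ⟩ := exists_eq_polarPoint x
  have hr : 0 < ‖x‖ := norm_pos_iff.2 hx
  have hA := h.differential_radial hr θ
  have hC := h.differential_angular hr θ
  have hform := h.form ‖x‖ θ hr.le
  rw [← hθ] at hA hC hform
  have hC' : differential φ x (!₂[-Real.sin θ, Real.cos θ]) = ‖x‖⁻¹ • (!₂[-(B * Real.sin (f ‖x‖) *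
      Real.sin (B * θ)), B * Real.sin (f ‖x‖) * Real.cos (B * θ), 0] : Space) := by
    rw [← hC, smul_smul, inv_mul_cancel₀ hr.ne', one_smul]
  have hcs := Real.sin_sq_add_cos_sq θ
  have e0 : frame 0 = Real.cos θ • (!₂[Real.cos θ, Real.sin θ] : Plane) -
      Real.sin θ • !₂[-Real.sin θ, Real.cos θ] := by
    ext i
    fin_cases i
    · simp [frame]; linear_combination -hcs
    · simp [frame]; ring
  have e1 : frame 1 = Real.sin θ • (!₂[Real.cos θ, Real.sin θ] : Plane) +
      Real.cos θ • !₂[-Real.sin θ, Real.cos θ] := by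
    ext i
    fin_cases i
    · simp [frame]; ring
    · simp [frame]; linear_combination -hcs
  have hcb := Real.sin_sq_add_cos_sq (B * θ)
  have hcf := Real.sin_sq_add_cos_sq (f ‖x‖)
  rw [chargeDensity, e0, e1, map_sub, map_add, map_smul, map_smul, map_smul, map_smul, hA, hC',
    hform, Matrix.det_fin_three]
  simp
  set sb := Real.sin (B * θ)
  set cb := Real.cos (B * θ)
  set sf := Real.sin (f ‖x‖)
  set cf := Real.cos (f ‖x‖)
  set d := deriv f ‖x‖
  set k := ‖x‖⁻¹ * B * d * sf
  linear_combination k * ((sb ^ 2 + cb ^ 2) * (sf ^ 2 + cf ^ 2)) * hcs +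
    k * (sf ^ 2 + cf ^ 2) * hcb + k * hcf

end IsAxiallySymmetric

/-! ### Divergence of the pullback metric: closedness and exactness -/

section

variable {B : ℤ} {f : ℝ → ℝ} {φ : Plane → S2}

theorem hasFDerivAt_comp_norm {P : ℝ → ℝ} {P' : ℝ} {x : Plane} (hx : x ≠ 0)
    (hP : HasDerivAt P P' ‖x‖) : HasFDerivAt (fun y : Plane => P ‖y‖) (P' • dr x) x :=
  hP.comp_hasFDerivAt x (hasFDerivAt_norm hx)

/-- The divergence of `P(r) (r dr)² + Q(r) (r² dθ)²`, evaluated on a vector. -/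
theorem sum_fderiv_radial_tensor {P Q : ℝ → ℝ} {P' Q' : ℝ} {x : Plane} (hx : x ≠ 0)
    (hP : HasDerivAt P P' ‖x‖) (hQ : HasDerivAt Q Q' ‖x‖) (w : Plane) :
    ∑ i : Fin 2, fderiv ℝ (fun y : Plane =>
        P ‖y‖ * ((y 0 * frame i 0 + y 1 * frame i 1) * (y 0 * w 0 + y 1 * w 1)) +
        Q ‖y‖ * ((y 0 * frame i 1 - y 1 * frame i 0) * (y 0 * w 1 - y 1 * w 0))) x (frame i) =
      (P' * ‖x‖ + 3 * P ‖x‖ - Q ‖x‖) * (x 0 * w 0 + x 1 * w 1) := by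
  have c0 := hasFDerivAt_coord 0 x
  have c1 := hasFDerivAt_coord 1 x
  have h1 : ∀ v : Plane, HasFDerivAt (fun y : Plane => y 0 * v 0 + y 1 * v 1) _ x := fun v =>
    (c0.mul_const (v 0)).fun_add (c1.mul_const (v 1))
  have h2 : ∀ v : Plane, HasFDerivAt (fun y : Plane => y 0 * v 1 - y 1 * v 0) _ x := fun v =>
    (c0.mul_const (v 1)).fun_sub (c1.mul_const (v 0))
  have h := fun i : Fin 2 =>
    ((hasFDerivAt_comp_norm hx hP).fun_mul ((h1 (frame i)).fun_mul (h1 w))).fun_add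
      ((hasFDerivAt_comp_norm hx hQ).fun_mul ((h2 (frame i)).fun_mul (h2 w)))
  simp only [fun i => (h i).fderiv]
  have hr : ‖x‖ ≠ 0 := norm_ne_zero_iff.2 hx
  have hn := norm_sq_plane x
  simp [Fin.sum_univ_two, frame, dr_apply hx]
  field_simp
  linear_combination -(P' * (x.ofLp 0 * w.ofLp 0 + x.ofLp 1 * w.ofLp 1)) * hn

namespace IsAxiallySymmetric

theorem divergence_eq (h : IsAxiallySymmetric B f φ) {x : Plane} (hx : x ≠ 0) :
    divergence (pullbackMetric φ) x = (2 * deriv f ‖x‖ * deriv (deriv f) ‖x‖ +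
      (deriv f ‖x‖ ^ 2 - (B : ℝ) ^ 2 / ‖x‖ ^ 2 * Real.sin (f ‖x‖) ^ 2) / ‖x‖) • dr x := by
  have hr : 0 < ‖x‖ := norm_pos_iff.2 hx
  have hf := h.hasDerivAt_profile hr
  have hf' := h.hasDerivAt_deriv_profile hr
  -- The coefficients are P = f'²/r² and Q = B² sin² f/r⁴: dividing by r² and r⁴ trades dr, dθ for r
  -- dr and r² dθ, whose components are linear in x.
  have hP := (hf'.fun_pow 2).fun_div (hasDerivAt_pow 2 ‖x‖) (by positivity)
  have hQ := ((hf.sin.fun_pow 2).const_mul ((B : ℝ) ^ 2)).fun_div (hasDerivAt_pow 4 ‖x‖)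
    (by positivity)
  ext w
  rw [divergence_apply (h.smooth.contDiff_pullbackMetric.differentiable (by simp) x)]
  have hev : ∀ i : Fin 2, (fun y => pullbackMetric φ y (frame i) w) =ᶠ[𝓝 x] fun y =>
      deriv f ‖y‖ ^ 2 / ‖y‖ ^ 2 *
        ((y 0 * frame i 0 + y 1 * frame i 1) * (y 0 * w 0 + y 1 * w 1)) +
      (B : ℝ) ^ 2 * Real.sin (f ‖y‖) ^ 2 / ‖y‖ ^ 4 *
        ((y 0 * frame i 1 - y 1 * frame i 0) * (y 0 * w 1 - y 1 * w 0)) := by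
    intro i
    filter_upwards [isOpen_ne.mem_nhds hx] with y hy
    have : ‖y‖ ≠ 0 := norm_ne_zero_iff.2 hy
    rw [h.pullbackMetric_eq hy, dr_apply hy, dr_apply hy, dθ_apply, dθ_apply]
    field_simp
  refine (Finset.sum_congr rfl fun i _ => congrArg (fun L : Plane →L[ℝ] ℝ => L (frame i))
    (hev i).fderiv_eq).trans ((sum_fderiv_radial_tensor hx hP hQ w).trans ?_)
  rw [smul_apply, dr_apply hx]
  simp only [smul_eq_mul]
  field_simp
  push_cast
  ring

theorem isClosedOneForm (h : IsAxiallySymmetric B f φ) :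
    IsClosedOneForm (divergence (pullbackMetric φ)) := by
  have hs := h.smooth.contDiff_divergence
  refine ⟨hs, fun x v w => ?_⟩
  set η := divergence (pullbackMetric φ)
  have hηd : Differentiable ℝ η := hs.differentiable (by simp)
  have hηv : ∀ x v w, fderiv ℝ η x v w = fderiv ℝ (fun y => η y w) x v := by
    intro x v w
    rw [((hηd x).hasFDerivAt.clm_apply (hasFDerivAt_const w _)).fderiv]
    simp
  have hcont : ∀ v w, Continuous fun x => fderiv ℝ η x v w := fun v w =>
    ((contDiff_fderiv_apply hs v).clm_apply contDiff_const).continuous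
  -- The polar formula fails at the origin, but dη is continuous and the punctured plane is dense.
  refine congrFun (Continuous.ext_on (dense_compl_singleton (0 : Plane))
    (f := fun x => fderiv ℝ η x v w - fderiv ℝ η x w v) (g := fun _ => 0)
    ((hcont v w).sub (hcont w v)) continuous_const fun x hx => ?_) x
  have hx : x ≠ 0 := hx
  have hr : 0 < ‖x‖ := norm_pos_iff.2 hx
  have hf := h.hasDerivAt_profile hr
  have hf' := h.hasDerivAt_deriv_profile hr
  have hf'' : DifferentiableAt ℝ (deriv (deriv f)) ‖x‖ := by
    have h1 := ((contDiffOn_infty_iff_deriv_of_isOpen isOpen_Ioi).1 h.profile_smooth).2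
    exact ((((contDiffOn_infty_iff_deriv_of_isOpen isOpen_Ioi).1 h1).2.contDiffAt
      (Ioi_mem_nhds hr)).differentiableAt (by simp))
  set m : ℝ → ℝ := fun s => (2 * deriv f s * deriv (deriv f) s +
    (deriv f s ^ 2 - (B : ℝ) ^ 2 / s ^ 2 * Real.sin (f s) ^ 2) / s) / s with hm
  have hmd : DifferentiableAt ℝ m ‖x‖ := by
    have h1 := hf.differentiableAt
    have h2 := hf'.differentiableAt
    have h3 : ‖x‖ ^ 2 ≠ 0 := by positivity
    have h4 : ‖x‖ ≠ 0 := hr.ne'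
    have h5 : DifferentiableAt ℝ (fun s : ℝ => s) ‖x‖ := differentiableAt_id
    exact (((((h2.const_mul 2).fun_mul hf'').fun_add (((h2.fun_pow 2).fun_sub
      (((differentiableAt_const _).fun_div (h5.fun_pow 2) h3).fun_mul (h1.sin.fun_pow 2))).fun_div
        h5 h4)).fun_div h5 h4))
  have hev : ∀ w : Plane, (fun y => η y w) =ᶠ[𝓝 x] fun y =>
      m ‖y‖ * (y 0 * w 0 + y 1 * w 1) := by
    intro w
    filter_upwards [isOpen_ne.mem_nhds hx] with y hy
    change divergence (pullbackMetric φ) y w = _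
    rw [h.divergence_eq hy, smul_apply, dr_apply hy, smul_eq_mul, hm]
    ring
  have hlin : ∀ w : Plane, HasFDerivAt (fun y : Plane => y 0 * w 0 + y 1 * w 1) _ x := fun w =>
    ((hasFDerivAt_coord 0 x).mul_const (w 0)).fun_add ((hasFDerivAt_coord 1 x).mul_const (w 1))
  simp only [hηv, (hev _).fderiv_eq,
    fun w => ((hasFDerivAt_comp_norm hx hmd.hasDerivAt).fun_mul (hlin w)).fderiv]
  -- Here dη = m'(r) dr ∧ (r dr) = 0.
  simp [dr_apply hx]
  ring

/-- The Poincaré lemma on the convex set ℝ² gives u; it is smooth because its differential is. -/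
theorem isExactOneForm (h : IsAxiallySymmetric B f φ) :
    IsExactOneForm (divergence (pullbackMetric φ)) := by
  obtain ⟨hs, hc⟩ := h.isClosedOneForm
  obtain ⟨u, hu⟩ := convex_univ.exists_forall_hasFDerivAt_of_fderiv_symmetric isOpen_univ
    (hs.differentiable (by simp)).differentiableOn fun x _ v w => sub_eq_zero.1 (hc x v w)
  have hfd : fderiv ℝ u = divergence (pullbackMetric φ) := funext fun x => (hu x trivial).fderiv
  refine ⟨u, contDiff_infty_iff_fderiv.2 ⟨fun x => (hu x trivial).differentiableAt, ?_⟩,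
    fun x => by rw [hfd]⟩
  rwa [hfd]

/-! ### Limit at infinity, energy and degree -/

/-- The distance to the north pole depends only on the radius; this yields both the limit at
infinity and the constancy of φ where f vanishes. -/
theorem norm_sub_north_sq (h : IsAxiallySymmetric B f φ) (x : Plane) :
    ‖(φ x : Space) - !₂[0, 0, 1]‖ ^ 2 = 2 - 2 * Real.cos (f ‖x‖) := by
  obtain ⟨θ, hθ⟩ := exists_eq_polarPoint x
  have hform := h.form ‖x‖ θ (norm_nonneg _)
  rw [← hθ] at hform
  rw [hform, EuclideanSpace.norm_sq_eq]
  simp [Fin.sum_univ_three]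
  linear_combination Real.sin (f ‖x‖) ^ 2 * Real.sin_sq_add_cos_sq (B * θ) +
    Real.sin_sq_add_cos_sq (f ‖x‖)

theorem tendsto_cocompact (h : IsAxiallySymmetric B f φ) :
    Tendsto (fun x => (φ x : Space)) (cocompact Plane) (𝓝 (!₂[0, 0, 1])) := by
  have h1 : Tendsto (fun x : Plane => 2 - 2 * Real.cos (f ‖x‖)) (cocompact Plane) (𝓝 0) := by
    have := ((Real.continuous_cos.tendsto 0).comp (h.profile_infty.comp
      (tendsto_norm_cocompact_atTop (E := Plane)))).const_mul 2 |>.const_sub 2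
    simpa using this
  rw [tendsto_iff_norm_sub_tendsto_zero]
  have h2 := (Real.continuous_sqrt.tendsto 0).comp h1
  rw [Real.sqrt_zero] at h2
  refine h2.congr fun x => ?_
  rw [Function.comp, ← h.norm_sub_north_sq, Real.sqrt_sq (norm_nonneg _)]

theorem energyDensity_eq (h : IsAxiallySymmetric B f φ) {x : Plane} (hx : x ≠ 0) :
    energyDensity φ x =
      1 / 2 * (deriv f ‖x‖ ^ 2 + (B * Real.sin (f ‖x‖) / ‖x‖) ^ 2) := by
  have hr : ‖x‖ ≠ 0 := norm_ne_zero_iff.2 hx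
  have hn := norm_sq_plane x
  simp only [energyDensity, Fin.sum_univ_two, h.pullbackMetric_eq hx, dr_apply hx, dθ_apply]
  simp [frame]
  field_simp
  rw [show ‖x‖ ^ 2 = x.ofLp 0 ^ 2 + x.ofLp 1 ^ 2 from hn]
  ring

theorem _root_.BabySkyrme.IsSmooth.continuous_chargeDensity (h : IsSmooth φ) : Continuous (chargeDensity φ) := by
  have hk : ∀ (g : Plane → Space), Continuous g → ∀ k, Continuous fun x => g x k :=
    fun g hg k => (EuclideanSpace.proj k : Space →L[ℝ] ℝ).continuous.comp hg
  have h0 := hk _ h.contDiff_coe.continuous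
  have h1 := fun v => hk _ (contDiff_fderiv_apply h.contDiff_coe v).continuous
  refine continuous_const.mul (Continuous.matrix_det (continuous_matrix fun i j => ?_))
  fin_cases i
  · exact h0 j
  · exact h1 (frame 0) j
  · exact h1 (frame 1) j

/-- By |ab| ≤ (a² + b²)/2 with a = f' and b = B sin f/r, the energy density dominates the charge
density. -/
theorem integrable_chargeDensity (h : IsAxiallySymmetric B f φ) (hE : dirichletEnergy φ < ⊤) :
    Integrable (chargeDensity φ) := by
  refine (h.smooth.integrable_energyDensity_iff.2 hE).mono'
    h.smooth.continuous_chargeDensity.aestronglyMeasurable ?_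
  filter_upwards [compl_mem_ae_iff.2 (measure_singleton (0 : Plane))] with x hx
  rw [h.chargeDensity_eq hx, h.energyDensity_eq hx, norm_mul, Real.norm_eq_abs, Real.norm_eq_abs,
    abs_neg, abs_of_pos (by positivity)]
  have hpi : 1 / (4 * Real.pi) ≤ 1 := by
    rw [div_le_one (by positivity)]
    linarith [Real.pi_gt_three]
  refine (mul_le_of_le_one_left (abs_nonneg _) hpi).trans ?_
  have h1 : B * deriv f ‖x‖ * Real.sin (f ‖x‖) / ‖x‖ =
      deriv f ‖x‖ * (B * Real.sin (f ‖x‖) / ‖x‖) := by ring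
  rw [h1, abs_mul]
  nlinarith [sq_nonneg (|deriv f ‖x‖| - |B * Real.sin (f ‖x‖) / ‖x‖|),
    sq_abs (deriv f ‖x‖), sq_abs (B * Real.sin (f ‖x‖) / ‖x‖)]

theorem integral_chargeDensity (h : IsAxiallySymmetric B f φ) (hE : dirichletEnergy φ < ⊤) :
    ∫ x, chargeDensity φ x = B := by
  set g : ℝ → ℝ := fun s => -(1 / (4 * Real.pi)) * (B * deriv f s * Real.sin (f s) / s) with hg
  have hae : chargeDensity φ =ᵐ[volume] fun x => g ‖x‖ := by
    filter_upwards [compl_mem_ae_iff.2 (measure_singleton (0 : Plane))] with x hx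
      using h.chargeDensity_eq hx
  have hint : IntegrableOn (fun y : ℝ => y ^ (2 - 1) • g y) (Ioi 0) := by
    have := (integrable_fun_norm_addHaar (volume : Measure Plane) (f := g)).1
      ((integrable_congr hae).1 (h.integrable_chargeDensity hE))
    simpa using this
  -- The polar weight y^(2-1) cancels the 1/y in the density and leaves an exact derivative.
  have hder : ∀ y ∈ Ioi (0 : ℝ), HasDerivAt (fun s => B / (4 * Real.pi) * Real.cos (f s))
      (y ^ (2 - 1) • g y) y := by
    intro y hy
    have hy : 0 < y := hy
    refine ((h.hasDerivAt_profile hy).cos.const_mul _).congr_deriv ?_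
    simp [hg]
    field_simp
  have hcos : ∀ s : ℝ, 0 ≤ s → Real.cos (f s) = (φ (polarPoint s 0) : Space) 2 := by
    intro s hs
    rw [h.form s 0 hs]
    rfl
  -- The profile is not assumed continuous at 0; continuity of cos f there comes from the third
  -- component of φ along a ray.
  have hcont : ContinuousWithinAt (fun s => B / (4 * Real.pi) * Real.cos (f s)) (Ici 0) 0 := by
    have hp : Continuous fun s : ℝ => polarPoint s 0 := by
      unfold polarPoint
      fun_prop
    have : Continuous fun s : ℝ => B / (4 * Real.pi) * (φ (polarPoint s 0) : Space) 2 :=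
      continuous_const.mul ((EuclideanSpace.proj 2 : Space →L[ℝ] ℝ).continuous.comp
        (h.smooth.contDiff_coe.continuous.comp hp))
    refine this.continuousWithinAt.congr (fun s hs => ?_) ?_
    · rw [hcos s hs]
    · rw [hcos 0 le_rfl]
  have hlim : Tendsto (fun s => B / (4 * Real.pi) * Real.cos (f s)) atTop
      (𝓝 (B / (4 * Real.pi) * Real.cos 0)) :=
    ((Real.continuous_cos.tendsto 0).comp h.profile_infty).const_mul _
  rw [integral_congr_ae hae, integral_fun_norm_addHaar]
  have hfin : Module.finrank ℝ Plane = 2 := by simp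
  -- The angular factor is 2 times the area π of the unit disc, and the radial integral is B/(4π) ·
  -- (1 - (-1)).
  rw [hfin, integral_Ioi_of_hasDerivAt_of_tendsto hcont hder hint hlim, h.profile_zero,
    Measure.real, EuclideanSpace.volume_ball_fin_two]
  simp [ENNReal.toReal_ofReal Real.pi_pos.le]
  field_simp
  ring

theorem hasDegree (h : IsAxiallySymmetric B f φ) (hE : dirichletEnergy φ < ⊤) :
    HasDegree φ B where
  smooth := h.smooth
  finite_energy := hE
  limit := by
    refine ⟨⟨!₂[0, 0, 1], ?_⟩, tendsto_subtype_rng.2 h.tendsto_cocompact⟩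
    simp [EuclideanSpace.norm_eq, Fin.sum_univ_three]
  integrable := h.integrable_chargeDensity hE
  integral_eq := h.integral_chargeDensity hE

theorem restrictedHarmonic (h : IsAxiallySymmetric B f φ) (hE : dirichletEnergy φ < ⊤) :
    RestrictedHarmonic φ :=
  restrictedHarmonic_of_isExactOneForm h.smooth hE h.isExactOneForm

end IsAxiallySymmetric

end

/-! ### Maps that are constant outside a disc -/

theorem isSmooth_of_contDiff_coe {φ : Plane → S2} (h : ContDiff ℝ ∞ (fun y => (φ y : Space))) :
    IsSmooth φ :=
  ContMDiff.codRestrict_sphere h.contMDiff fun x => (φ x).2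

theorem dirichletEnergy_lt_top_of_eq_off_compact {φ : Plane → S2} (h : IsSmooth φ) {K : Set Plane}
    (hK : IsCompact K) {p : Space} (hp : ∀ x ∉ K, (φ x : Space) = p) :
    dirichletEnergy φ < ⊤ := by
  refine h.integrable_energyDensity_iff.1
    (h.contDiff_energyDensity.continuous.integrable_of_hasCompactSupport
      (HasCompactSupport.intro hK fun x hx => ?_))
  have hev : (fun y => (φ y : Space)) =ᶠ[𝓝 x] fun _ => p := by
    filter_upwards [hK.isClosed.isOpen_compl.mem_nhds hx] with y hy using hp y hy
  have hd : differential φ x = 0 := by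
    rw [differential, hev.fderiv_eq]
    simp
  simp [energyDensity, pullbackMetric_apply, hd]

namespace IsAxiallySymmetric

variable {B : ℤ} {f : ℝ → ℝ} {φ : Plane → S2} {R : ℝ}

theorem radius_pos (h : IsAxiallySymmetric B f φ) (hR : ∀ r, R ≤ r → f r = 0) : 0 < R := by
  by_contra! hneg
  exact Real.pi_ne_zero (h.profile_zero.symm.trans (hR 0 hneg))

theorem eq_north (h : IsAxiallySymmetric B f φ) (hR : ∀ r, R ≤ r → f r = 0) {x : Plane}
    (hx : R ≤ ‖x‖) : (φ x : Space) = !₂[0, 0, 1] := by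
  have := h.norm_sub_north_sq x
  rw [hR _ hx, Real.cos_zero] at this
  exact sub_eq_zero.1 (norm_eq_zero.1 (pow_eq_zero_iff two_ne_zero |>.1 (by linarith)))

/-- The boundary circle matters, since discs may touch: there f' exists and equals its right
derivative, which is 0. -/
theorem differential_eq_zero (h : IsAxiallySymmetric B f φ) (hR : ∀ r, R ≤ r → f r = 0)
    {x : Plane} (hx : R ≤ ‖x‖) : differential φ x = 0 := by
  have hr : 0 < ‖x‖ := (h.radius_pos hR).trans_le hx
  have hd : deriv f ‖x‖ = 0 := by
    refine (uniqueDiffWithinAt_Ici ‖x‖).eq_deriv (Ici ‖x‖)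
      (h.hasDerivAt_profile hr).hasDerivWithinAt
      ((hasDerivWithinAt_const ‖x‖ (Ici ‖x‖) (0 : ℝ)).congr (fun r hrx => hR r (hx.trans hrx))
        (hR _ hx))
  ext1 v
  have := h.pullbackMetric_eq (norm_pos_iff.1 hr) v v
  rw [hd, hR _ hx, Real.sin_zero, pullbackMetric_apply] at this
  exact inner_self_eq_zero.1 (this.trans (by ring))

theorem dirichletEnergy_lt_top (h : IsAxiallySymmetric B f φ) (hR : ∀ r, R ≤ r → f r = 0) :
    dirichletEnergy φ < ⊤ := by
  refine dirichletEnergy_lt_top_of_eq_off_compact h.smooth (isCompact_closedBall 0 R)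
    fun x hx => h.eq_north hR ?_
  rw [mem_closedBall_zero_iff, not_le] at hx
  exact hx.le

end IsAxiallySymmetric

/-! ### Superpositions on non-overlapping discs -/

section Superposition

variable {n : ℕ} {B : Fin n → ℤ} {f : Fin n → ℝ → ℝ} {φ : Fin n → Plane → S2}
  {c : Fin n → Plane} {R : Fin n → ℝ} {Φ : Plane → S2}

theorem IsSuperposition.radius_le (hS : IsSuperposition c R φ Φ) {i j : Fin n} (hij : i ≠ j)
    {x : Plane} (hx : ‖x - c i‖ ≤ R i) : R j ≤ ‖x - c j‖ := by
  have h1 := hS.disjoint i j hij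
  have h2 := dist_triangle_left (c i) (c j) x
  rw [dist_eq_norm x, dist_eq_norm x] at h2
  linarith

/-- At most one summand is nonzero at each point. A single global formula makes Φ smooth with no
gluing along the boundary circles. -/
theorem IsSuperposition.eq_sum (hS : IsSuperposition c R φ Φ)
    (h : ∀ i, IsAxiallySymmetric (B i) (f i) (φ i)) (hR : ∀ i r, R i ≤ r → f i r = 0) (x : Plane) :
    (Φ x : Space) = !₂[0, 0, 1] + ∑ i, ((φ i (x - c i) : Space) - !₂[0, 0, 1]) := by
  by_cases hx : ∃ i, ‖x - c i‖ ≤ R i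
  · obtain ⟨i, hi⟩ := hx
    rw [hS.inside i x (by rwa [dist_eq_norm]), Finset.sum_eq_single i]
    · abel
    · intro j _ hji
      rw [(h j).eq_north (hR j) (hS.radius_le hji.symm hi), sub_self]
    · simp
  · push Not at hx
    rw [hS.outside x (by simpa only [dist_eq_norm] using hx), Finset.sum_eq_zero, add_zero]
    intro i _
    rw [(h i).eq_north (hR i) (hx i).le, sub_self]

theorem IsSuperposition.isSmooth (hS : IsSuperposition c R φ Φ)
    (h : ∀ i, IsAxiallySymmetric (B i) (f i) (φ i)) (hR : ∀ i r, R i ≤ r → f i r = 0) :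
    IsSmooth Φ := by
  refine isSmooth_of_contDiff_coe ?_
  rw [funext (hS.eq_sum h hR)]
  exact contDiff_const.add (ContDiff.sum fun i _ =>
    ((h i).smooth.contDiff_coe.comp (contDiff_id.sub contDiff_const)).sub contDiff_const)

theorem IsSuperposition.differential_eq (hS : IsSuperposition c R φ Φ)
    (h : ∀ i, IsAxiallySymmetric (B i) (f i) (φ i)) (hR : ∀ i r, R i ≤ r → f i r = 0) (x : Plane) :
    differential Φ x = ∑ i, differential (φ i) (x - c i) := by
  have hi : ∀ i ∈ Finset.univ, HasFDerivAt
      (fun y => (φ i (y - c i) : Space) - !₂[0, 0, 1]) (differential (φ i) (x - c i)) x := by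
    intro i _
    have := ((h i).smooth.contDiff_coe.differentiable (by simp) (x - c i)).hasFDerivAt
    exact ((hasFDerivAt_comp_sub (c i)).2 this).sub_const _
  rw [differential, funext (hS.eq_sum h hR)]
  exact ((HasFDerivAt.fun_sum hi).const_add _).fderiv

theorem IsSuperposition.pullbackMetric_eq (hS : IsSuperposition c R φ Φ)
    (h : ∀ i, IsAxiallySymmetric (B i) (f i) (φ i)) (hR : ∀ i r, R i ≤ r → f i r = 0) (x : Plane) :
    pullbackMetric Φ x = ∑ i, pullbackMetric (φ i) (x - c i) := by
  ext v w
  simp only [sum_apply, pullbackMetric_apply, hS.differential_eq h hR]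
  rw [sum_inner]
  refine Finset.sum_congr rfl fun i _ => ?_
  -- The cross terms vanish: of two different differentials at x, at least one is zero.
  rw [inner_sum, Finset.sum_eq_single i _ (by simp)]
  intro j _ hji
  rcases le_total ‖x - c i‖ (R i) with hx | hx
  · rw [(h j).differential_eq_zero (hR j) (hS.radius_le hji.symm hx)]
    simp
  · rw [(h i).differential_eq_zero (hR i) hx]
    simp

theorem IsSuperposition.divergence_eq (hS : IsSuperposition c R φ Φ)
    (h : ∀ i, IsAxiallySymmetric (B i) (f i) (φ i)) (hR : ∀ i r, R i ≤ r → f i r = 0) (x : Plane) :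
    divergence (pullbackMetric Φ) x = ∑ i, divergence (pullbackMetric (φ i)) (x - c i) := by
  have hd : fderiv ℝ (pullbackMetric Φ) x = ∑ i, fderiv ℝ (pullbackMetric (φ i)) (x - c i) := by
    rw [funext (hS.pullbackMetric_eq h hR)]
    exact (HasFDerivAt.fun_sum fun i _ => (hasFDerivAt_comp_sub (c i)).2
      ((h i).smooth.contDiff_pullbackMetric.differentiable (by simp) (x - c i)).hasFDerivAt).fderiv
  simp only [divergence, hd, sum_apply]
  exact Finset.sum_comm

theorem IsSuperposition.isExactOneForm (hS : IsSuperposition c R φ Φ)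
    (h : ∀ i, IsAxiallySymmetric (B i) (f i) (φ i)) (hR : ∀ i r, R i ≤ r → f i r = 0) :
    IsExactOneForm (divergence (pullbackMetric Φ)) := by
  choose u hu hdu using fun i => (h i).isExactOneForm
  refine ⟨fun x => ∑ i, u i (x - c i),
    ContDiff.sum fun i _ => (hu i).comp (contDiff_id.sub contDiff_const), fun x => ?_⟩
  rw [hS.divergence_eq h hR, (HasFDerivAt.fun_sum fun i _ => (hasFDerivAt_comp_sub (c i)).2
    ((hu i).differentiable (by simp) (x - c i)).hasFDerivAt).fderiv]
  exact Finset.sum_congr rfl fun i _ => hdu i _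

theorem IsSuperposition.restrictedHarmonic (hS : IsSuperposition c R φ Φ)
    (h : ∀ i, IsAxiallySymmetric (B i) (f i) (φ i)) (hR : ∀ i r, R i ≤ r → f i r = 0) :
    RestrictedHarmonic Φ := by
  refine restrictedHarmonic_of_isExactOneForm (hS.isSmooth h hR) ?_ (hS.isExactOneForm h hR)
  refine dirichletEnergy_lt_top_of_eq_off_compact (hS.isSmooth h hR)
    (isCompact_iUnion fun i => isCompact_closedBall (c i) (R i)) fun x hx => hS.outside x ?_
  simpa using hx

end Superposition

/-! ### An example in every degree -/

section Example

/-- A smooth profile that equals `π` on `[0, 1]` and vanishes on `[2, ∞)`. -/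
noncomputable def cutoffProfile (r : ℝ) : ℝ := Real.pi * (1 - Real.smoothTransition (r - 1))

theorem contDiff_cutoffProfile : ContDiff ℝ ∞ cutoffProfile :=
  contDiff_const.mul (contDiff_const.sub
    (Real.smoothTransition.contDiff.comp (contDiff_id.sub contDiff_const)))

theorem cutoffProfile_of_le_one {r : ℝ} (hr : r ≤ 1) : cutoffProfile r = Real.pi := by
  simp [cutoffProfile, Real.smoothTransition.zero_of_nonpos (sub_nonpos.2 hr)]

theorem cutoffProfile_of_two_le {r : ℝ} (hr : 2 ≤ r) : cutoffProfile r = 0 := by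
  simp [cutoffProfile, Real.smoothTransition.one_of_one_le (by linarith : 1 ≤ r - 1)]

/-- The phase `e^{iBθ}` of a point of the plane. -/
noncomputable def phase (B : ℤ) (x : Plane) : ℂ :=
  (((‖x‖⁻¹ * x 0 : ℝ) : ℂ) + ((‖x‖⁻¹ * x 1 : ℝ) : ℂ) * Complex.I) ^ B

theorem phase_polarPoint (B : ℤ) {r : ℝ} (hr : 0 < r) (θ : ℝ) :
    phase B (polarPoint r θ) = ⟨Real.cos (B * θ), Real.sin (B * θ)⟩ := by
  have h0 : ‖polarPoint r θ‖⁻¹ * polarPoint r θ 0 = Real.cos θ := by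
    rw [norm_polarPoint hr.le]
    simp [polarPoint, hr.ne']
  have h1 : ‖polarPoint r θ‖⁻¹ * polarPoint r θ 1 = Real.sin θ := by
    rw [norm_polarPoint hr.le]
    simp [polarPoint, hr.ne']
  rw [phase, h0, h1, Complex.ofReal_cos, Complex.ofReal_sin, ← Complex.exp_mul_I,
    ← Complex.exp_int_mul, ← mul_assoc]
  have : ((B : ℂ) * (θ : ℂ)) = ((B * θ : ℝ) : ℂ) := by push_cast; rfl
  rw [this]
  apply Complex.ext
  · exact Complex.exp_ofReal_mul_I_re _
  · exact Complex.exp_ofReal_mul_I_im _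

theorem contDiffAt_phase (B : ℤ) {x : Plane} (hx : x ≠ 0) : ContDiffAt ℝ ∞ (phase B) x := by
  have hn : ContDiffAt ℝ ∞ (fun y : Plane => ‖y‖⁻¹) x :=
    (contDiffAt_norm ℝ hx).inv (norm_ne_zero_iff.2 hx)
  have hc : ∀ i : Fin 2, ContDiffAt ℝ ∞ (fun y : Plane => ((‖y‖⁻¹ * y i : ℝ) : ℂ)) x := fun i =>
    Complex.ofRealCLM.contDiff.contDiffAt.comp x
      (hn.mul (EuclideanSpace.proj i : Plane →L[ℝ] ℝ).contDiff.contDiffAt)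
  have hw := (hc 0).add ((hc 1).mul (contDiffAt_const (c := Complex.I)))
  -- Negative charges invert the base; it is nonzero since it equals cos θ + i sin θ.
  have hne : (((‖x‖⁻¹ * x 0 : ℝ) : ℂ) + ((‖x‖⁻¹ * x 1 : ℝ) : ℂ) * Complex.I) ≠ 0 := by
    obtain ⟨θ, hθ⟩ := exists_eq_polarPoint x
    intro h0
    have := phase_polarPoint 1 (norm_pos_iff.2 hx) θ
    rw [← hθ, phase, h0] at this
    have h1 := congrArg Complex.re this
    have h2 := congrArg Complex.im this
    have h3 := Real.sin_sq_add_cos_sq θ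
    simp at h1 h2
    rw [← h1, ← h2] at h3
    simp at h3
  cases B with
  | ofNat k => exact (hw.pow k).congr_of_eventuallyEq (.of_forall fun y => zpow_natCast _ k)
  | negSucc k =>
    exact ((hw.pow (k + 1)).inv (pow_ne_zero _ hne)).congr_of_eventuallyEq
      (.of_forall fun y => zpow_negSucc _ k)

/-- The axially symmetric map with the cut-off profile, as a map to the ambient space. -/
noncomputable def modelMapAux (B : ℤ) (x : Plane) : Space :=
  !₂[Real.sin (cutoffProfile ‖x‖) * (phase B x).re, Real.sin (cutoffProfile ‖x‖) * (phase B x).im,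
    Real.cos (cutoffProfile ‖x‖)]

theorem modelMapAux_polarPoint (B : ℤ) {r : ℝ} (hr : 0 ≤ r) (θ : ℝ) :
    modelMapAux B (polarPoint r θ) = !₂[Real.sin (cutoffProfile r) * Real.cos (B * θ),
      Real.sin (cutoffProfile r) * Real.sin (B * θ), Real.cos (cutoffProfile r)] := by
  rcases hr.eq_or_lt with rfl | hr'
  -- At the origin the phase takes a default value, which the factor sin π = 0 removes.
  · simp [modelMapAux, norm_polarPoint, cutoffProfile_of_le_one]
  · rw [modelMapAux, norm_polarPoint hr, phase_polarPoint B hr']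

theorem norm_modelMapAux (B : ℤ) (x : Plane) : ‖modelMapAux B x‖ = 1 := by
  obtain ⟨θ, hθ⟩ := exists_eq_polarPoint x
  rw [hθ, modelMapAux_polarPoint B (norm_nonneg x), ← sq_eq_sq₀ (norm_nonneg _) zero_le_one,
    EuclideanSpace.norm_sq_eq]
  simp [Fin.sum_univ_three]
  linear_combination Real.sin (cutoffProfile ‖x‖) ^ 2 * Real.sin_sq_add_cos_sq (B * θ) +
    Real.sin_sq_add_cos_sq (cutoffProfile ‖x‖)

/-- The axially symmetric map of charge `B` with the cut-off profile. -/
noncomputable def modelMap (B : ℤ) (x : Plane) : S2 :=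
  ⟨modelMapAux B x, mem_sphere_zero_iff_norm.2 (norm_modelMapAux B x)⟩

theorem contDiff_modelMapAux (B : ℤ) : ContDiff ℝ ∞ (modelMapAux B) := by
  rw [contDiff_iff_contDiffAt]
  intro x
  by_cases hx : x = 0
  -- On the unit disc the profile is π, so the map is constantly the south pole.
  · refine (contDiffAt_const (c := (!₂[0, 0, -1] : Space))).congr_of_eventuallyEq ?_
    filter_upwards [Metric.ball_mem_nhds x one_pos] with y hy
    rw [hx, mem_ball_zero_iff] at hy
    simp [modelMapAux, cutoffProfile_of_le_one hy.le]
  · have hf : ContDiffAt ℝ ∞ (fun y : Plane => cutoffProfile ‖y‖) x :=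
      contDiff_cutoffProfile.contDiffAt.comp x (contDiffAt_norm ℝ hx)
    have hp := contDiffAt_phase B hx
    rw [contDiffAt_euclidean]
    intro i
    fin_cases i
    · exact hf.sin.mul (Complex.reCLM.contDiff.contDiffAt.comp x hp)
    · exact hf.sin.mul (Complex.imCLM.contDiff.contDiffAt.comp x hp)
    · exact hf.cos

theorem isAxiallySymmetric_modelMap (B : ℤ) :
    IsAxiallySymmetric B cutoffProfile (modelMap B) where
  profile_smooth := contDiff_cutoffProfile.contDiffOn
  profile_zero := cutoffProfile_of_le_one zero_le_one
  profile_infty := tendsto_const_nhds.congr' (by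
    filter_upwards [eventually_ge_atTop 2] with r hr using (cutoffProfile_of_two_le hr).symm)
  smooth := isSmooth_of_contDiff_coe (contDiff_modelMapAux B)
  form _ θ hr := modelMapAux_polarPoint B hr θ

end Example

end BabySkyrme

theorem mainTheorem12 :
    -- every axially symmetric map
    (∀ (B : ℤ) (f : ℝ → ℝ) (φ : BabySkyrme.Plane → BabySkyrme.S2),
      BabySkyrme.IsAxiallySymmetric B f φ →
        (∀ x : BabySkyrme.Plane, x ≠ 0 → ∀ v w : BabySkyrme.Plane,
          BabySkyrme.pullbackMetric φ x v w =
            deriv f ‖x‖ ^ 2 * (BabySkyrme.dr x v * BabySkyrme.dr x w) +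
              (B : ℝ) ^ 2 * Real.sin (f ‖x‖) ^ 2 *
                (BabySkyrme.dθ x v * BabySkyrme.dθ x w)) ∧
        (∀ x : BabySkyrme.Plane, x ≠ 0 →
          BabySkyrme.divergence (BabySkyrme.pullbackMetric φ) x =
            (2 * deriv f ‖x‖ * deriv (deriv f) ‖x‖ +
              (deriv f ‖x‖ ^ 2 - (B : ℝ) ^ 2 / ‖x‖ ^ 2 * Real.sin (f ‖x‖) ^ 2) / ‖x‖) •
                BabySkyrme.dr x) ∧
        BabySkyrme.IsClosedOneForm (BabySkyrme.divergence (BabySkyrme.pullbackMetric φ)) ∧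
        BabySkyrme.IsExactOneForm (BabySkyrme.divergence (BabySkyrme.pullbackMetric φ)) ∧
        (BabySkyrme.dirichletEnergy φ < ⊤ →
          BabySkyrme.RestrictedHarmonic φ ∧ BabySkyrme.HasDegree φ B)) ∧
    -- examples in every degree class, with compactly supported profile
    (∀ B : ℤ, ∃ (f : ℝ → ℝ) (φ : BabySkyrme.Plane → BabySkyrme.S2) (R : ℝ),
      BabySkyrme.IsAxiallySymmetric B f φ ∧ (∀ r : ℝ, R ≤ r → f r = 0) ∧
        BabySkyrme.RestrictedHarmonic φ ∧ BabySkyrme.HasDegree φ B) ∧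
    -- superpositions of compactly supported axially symmetric maps
    (∀ (n : ℕ) (B : Fin n → ℤ) (f : Fin n → ℝ → ℝ)
      (φ : Fin n → BabySkyrme.Plane → BabySkyrme.S2)
      (c : Fin n → BabySkyrme.Plane) (R : Fin n → ℝ)
      (Φ : BabySkyrme.Plane → BabySkyrme.S2),
      (∀ i : Fin n, BabySkyrme.IsAxiallySymmetric (B i) (f i) (φ i)) →
      (∀ (i : Fin n) (r : ℝ), R i ≤ r → f i r = 0) →
      BabySkyrme.IsSuperposition c R φ Φ →
        BabySkyrme.RestrictedHarmonic Φ) := by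
  refine ⟨fun B f φ h => ⟨fun x hx v w => h.pullbackMetric_eq hx v w,
    fun x hx => h.divergence_eq hx, h.isClosedOneForm, h.isExactOneForm,
    fun hE => ⟨h.restrictedHarmonic hE, h.hasDegree hE⟩⟩, fun B => ?_,
    fun n B f φ c R Φ h hR hS => hS.restrictedHarmonic h hR⟩
  have h := BabySkyrme.isAxiallySymmetric_modelMap B
  have hR : ∀ r : ℝ, 2 ≤ r → BabySkyrme.cutoffProfile r = 0 := fun r hr =>
    BabySkyrme.cutoffProfile_of_two_le hr
  have hE := h.dirichletEnergy_lt_top hR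
  exact ⟨_, _, 2, h, hR, h.restrictedHarmonic hE, h.hasDegree hE⟩
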